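/- Let $\varphi$ be a CNF, i.e. a finite set of clauses, each clause being a finite set of literals. The incidence graph of $\varphi$ has as vertices the variables occurring in $\varphi$ and the clauses of $\varphi$, a variable being adjacent to every clause in which it occurs. A tree decomposition $(T,\mathbf B)$ of this graph, with $T$ a finite rooted tree, is called \emph{one-sided} if for each clause $C$ the nodes of $T$ whose bags contain $C$ induce a directed path of $T$ (each node of the path being followed by one of its children). Its width is the largest size of a bag minus one, and the one-sided treewidth of $\varphi$ is the smallest width of a one-sided tree decomposition. A \emph{regular resolution refutation} of $\varphi$ is a finite directed acyclic graph $H$ with exactly one source such that: every non-sink vertex is labelled with a variable $x$ of $\varphi$ and has exactly two out-neighbours, one of its out-edges being labelled $x$ and the other $\neg x$; no variable labels two distinct vertices of the same directed path; every sink is labelled with a clause $C$ of $\varphi$ such that, for each directed path $P$ from the source to this sink, the negation of every literal of $C$ labels an edge of $P$. The size of $H$ is its number of vertices. \textbf{Theorem.} There is an absolute constant $c$ such that, if $\varphi$ is an unsatisfiable CNF with $n$ variables whose incidence graph has a one-sided tree decomposition of width $k$, then $\varphi$ has a regular resolution refutation of size at most $c\cdot 4^k\cdot \max(n,1)$. Consequently,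 regular resolution is fixed-parameter tractable in one-sided treewidth: there are a function $f:\mathbb N\to\mathbb N$ and a constant $d$ such that every unsatisfiable CNF with $n$ variables and one-sided treewidth at most $k$ has a regular resolution refutation of size at most $f(k)\cdot \max(n,1)^d$. -/

import Mathlib

universe u v

namespace PropCNF



/-- A literal: a variable together with a sign; `(x, true)` is the literal `x` and
`(x, false)` is the literal `¬x`. -/
abbrev Literal (α : Type u) : Type u := α × Bool

/-- A clause is a finite set of literals. -/
abbrev Clause (α : Type u) : Type u := Finset (Literal α)

/-- A CNF is a finite set of clauses. -/
abbrev CNF (α : Type u) : Type u := Finset (Clause α)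

/-- The opposite literal. -/
def Literal.neg {α : Type u} (l : Literal α) : Literal α := (l.1, !l.2)

/-- `Var(φ)`, the set of variables that occur in `φ`. -/
def CNF.vars {α : Type u} [DecidableEq α] (φ : CNF α) : Finset α :=
  φ.biUnion fun C => C.image Prod.fst

/-- No truth assignment satisfies all the clauses of `φ`. -/
def CNF.Unsatisfiable {α : Type u} (φ : CNF α) : Prop :=
  ¬ ∃ a : α → Bool, ∀ C ∈ φ, ∃ l ∈ C, a l.1 = l.2

/-- The incidence graph: its vertices are the variables and the clauses of `φ`, and a variable is
adjacent to the clauses it occurs in. -/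
def CNF.incidenceGraph {α : Type u} [DecidableEq α] (φ : CNF α) :
    SimpleGraph ({x : α // x ∈ CNF.vars φ} ⊕ {C : Clause α // C ∈ φ}) :=
  SimpleGraph.fromRel fun p q =>
    ∃ (x : {x : α // x ∈ CNF.vars φ}) (C : {C : Clause α // C ∈ φ}),
      p = Sum.inl x ∧ q = Sum.inr C ∧ ∃ l ∈ C.1, l.1 = x.1

/-- A tree decomposition of the graph `G` whose underlying tree is the rooted tree `T`. The rooted
tree is given by its ancestor order (the root is the least element), so that the edges of the
underlying tree are the edges of the Hasse diagram of `T`. -/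
structure TreeDecomposition {V : Type u} (G : SimpleGraph V) (T : RootedTree.{v}) where
  /-- the bag of a node -/
  bag : T → Finset V
  /-- every vertex is in some bag -/
  union : ∀ x : V, ∃ t : T, x ∈ bag t
  /-- both ends of every edge are in a common bag -/
  containment : ∀ x y : V, G.Adj x y → ∃ t : T, x ∈ bag t ∧ y ∈ bag t
  /-- the nodes whose bags contain a given vertex induce a connected subgraph of the tree -/
  connectivity : ∀ x : V, ((SimpleGraph.hasse T).induce {t : T | x ∈ bag t}).Connected

/-- The largest size of a bag, minus one. -/
def TreeDecomposition.width {V : Type u} {G : SimpleGraph V} {T : RootedTree.{v}} [Fintype T]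
    (D : TreeDecomposition G T) : ℕ :=
  (Finset.univ.sup fun t : T => (D.bag t).card) - 1

/-- A tree decomposition of the incidence graph is one-sided if, for each clause `C`, the nodes
whose bags contain `C` form a directed path: a sequence of nodes in which each node is followed by
one of its children. -/
def TreeDecomposition.IsOneSided {α : Type u} [DecidableEq α] {φ : CNF α} {T : RootedTree.{v}}
    (D : TreeDecomposition (CNF.incidenceGraph φ) T) : Prop :=
  ∀ C : {C : Clause α // C ∈ φ},
    ∃ p : List T, p.IsChain (fun s t => s ⋖ t) ∧ ∀ t : T, t ∈ p ↔ Sum.inr C ∈ D.bag t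

/-- The one-sided treewidth of `φ`: the smallest width of a one-sided tree decomposition of its
incidence graph. -/
noncomputable def CNF.oneSidedTreewidth {α : Type u} [DecidableEq α] (φ : CNF α) : ℕ :=
  sInf {w : ℕ | ∃ (T : RootedTree.{0}) (_ : Fintype T)
    (D : TreeDecomposition (CNF.incidenceGraph φ) T), D.IsOneSided ∧ D.width = w}

/-- What a vertex of a branching program carries: a non-sink is labelled with a variable `x` and
has an out-edge labelled `x` to `next true` and an out-edge labelled `¬x` to `next false`; a sink is
labelled with a clause. -/
inductive NodeData (α : Type u) (N : Type) : Type u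
  | query (x : α) (next : Bool → N) : NodeData α N
  | sink (C : Clause α) : NodeData α N

/-- A finite labelled directed graph with a designated vertex `root`. -/
structure BranchingProgram (α : Type u) where
  /-- the vertices -/
  Node : Type
  [fintypeNode : Fintype Node]
  /-- the designated vertex -/
  root : Node
  /-- the label of a vertex and its out-edges -/
  data : Node → NodeData α Node

namespace BranchingProgram

variable {α : Type u}

/-- The number of vertices. -/
def size (H : BranchingProgram α) : ℕ := @Fintype.card H.Node H.fintypeNode

/-- There is an edge from `a` to `b` labelled with the literal `l`. -/
def Edge (H : BranchingProgram α) (a : H.Node) (l : Literal α) (b : H.Node) : Prop :=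
  ∃ next : Bool → H.Node, H.data a = NodeData.query l.1 next ∧ next l.2 = b

/-- `H.Path a A b`: there is a directed path from `a` to `b` the labels of whose edges, in order,
are the literals `A`. -/
inductive Path (H : BranchingProgram α) : H.Node → List (Literal α) → H.Node → Prop
  | nil (a : H.Node) : Path H a [] a
  | cons {a b c : H.Node} {l : Literal α} {A : List (Literal α)} :
      H.Edge a l b → Path H b A c → Path H a (l :: A) c

/-- `H` is a regular resolution refutation of `φ`, in the form of a read-once branching program
whose sinks are labelled with falsified clauses of `φ`. -/
structure IsRegularResolution (H : BranchingProgram α) [DecidableEq α] (φ : CNF α) : Prop where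
  /-- there is no directed cycle -/
  acyclic : ∀ (a : H.Node) (A : List (Literal α)), H.Path a A a → A = []
  /-- `root` is the one and only source -/
  source : ∀ b : H.Node, (∀ (a : H.Node) (l : Literal α), ¬ H.Edge a l b) ↔ b = H.root
  /-- the two out-neighbours of a non-sink are distinct -/
  outNeighbours : ∀ (a : H.Node) (x : α) (next : Bool → H.Node),
    H.data a = NodeData.query x next → next true ≠ next false
  /-- non-sinks are labelled with variables of `φ` -/
  query_mem : ∀ (a : H.Node) (x : α) (next : Bool → H.Node),
    H.data a = NodeData.query x next → x ∈ CNF.vars φ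
  /-- no variable labels two distinct vertices of a directed path -/
  readOnce : ∀ (a b : H.Node) (A : List (Literal α)) (x : α) (next next' : Bool → H.Node),
    H.Path a A b → H.data a = NodeData.query x next → H.data b = NodeData.query x next' → a = b
  /-- sinks are labelled with clauses of `φ` -/
  sink_mem : ∀ (a : H.Node) (C : Clause α), H.data a = NodeData.sink C → C ∈ φ
  /-- the literals on a path from the root to a sink falsify the clause of the sink -/
  sink_falsified : ∀ (a : H.Node) (C : Clause α) (A : List (Literal α)),
    H.data a = NodeData.sink C → H.Path H.root A a → ∀ l ∈ C, Literal.neg l ∈ A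

end BranchingProgram

end PropCNF

/-! The refutation is a search for a falsified clause that walks down one branch of the tree.
Variables are ordered by their topmost node, ties being broken by a numbering, and are queried in
increasing order, so no path repeats a variable. When `x` is queried at its topmost node, the search
remembers only the values of the earlier variables in that bag and the clauses of the bag already
satisfied. This is a subset of the bag without `x`, so there are at most `n * 2 ^ k` states. Each
state keeps the residual formula below its node unsatisfiable.

Once the whole bag of `t` is known, satisfying assignments of the residual formulas at all children
could be glued into one at `t`, unless a clause not yet satisfied ends at `t`
(`ResidualUnsat.exists_child`). So the search either descends to a child or stops at such a clause.
One-sidedness enters at the stop: all nodes of that clause are then ancestors of `t` or `t` itself,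
so all its variables have been answered, and all its literals are false
(`Records.neg_mem_of_isOneSided`).

Both answers at a state may lead to the same next state, whereas out-neighbours must be distinct.
The vertices are therefore the pairs of state and answer, plus a root: `2 * (n * 2 ^ k) + 1` in all.
-/

namespace PropCNF

/-! ### Branching programs from read-once search strategies -/

namespace BranchingProgram

section EdgeProgram

variable {α : Type u} {S : Type}

/-- The vertices that can be reached from `none`, where a vertex is the last edge that was used
(`none` if there is none), an edge is a state together with an answer to its query, and `tgt` maps
an edge to the state it leads to or to the clause that is answered. -/
inductive Reachable (tgt : Option (S × Bool) → S ⊕ Clause α) : Option (S × Bool) → Prop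
  | root : Reachable tgt none
  | edge {p : Option (S × Bool)} {s : S} (b : Bool) :
      Reachable tgt p → tgt p = Sum.inl s → Reachable tgt (some (s, b))

/-- The branching program whose vertices are the reachable edges of a transition system. -/
noncomputable def edgeProgram [Finite S] (var : S → α) (tgt : Option (S × Bool) → S ⊕ Clause α) :
    BranchingProgram α where
  Node := {p : Option (S × Bool) // Reachable tgt p}
  fintypeNode := Fintype.ofFinite _
  root := ⟨none, .root⟩
  data p := match h : tgt p.1 with
    | Sum.inl s => NodeData.query (var s) fun b => ⟨some (s, b), .edge b p.2 h⟩
    | Sum.inr C => NodeData.sink C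

variable [Finite S] {var : S → α} {tgt : Option (S × Bool) → S ⊕ Clause α}

lemma edgeProgram_data_eq_query {p : (edgeProgram var tgt).Node} {x : α}
    {next : Bool → (edgeProgram var tgt).Node}
    (h : (edgeProgram var tgt).data p = NodeData.query x next) :
    ∃ s, tgt p.1 = Sum.inl s ∧ x = var s ∧ ∀ b, (next b).1 = some (s, b) := by
  simp only [edgeProgram] at h
  split at h
  · rename_i s hs
    injection h with h1 h2
    exact ⟨s, hs, h1.symm, fun b => by rw [← h2]⟩
  · cases h

lemma edgeProgram_data_eq_sink {p : (edgeProgram var tgt).Node} {C : Clause α}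
    (h : (edgeProgram var tgt).data p = NodeData.sink C) : tgt p.1 = Sum.inr C := by
  simp only [edgeProgram] at h
  split at h
  · cases h
  · rename_i C' hC
    injection h with h1
    rw [hC, h1]

lemma edgeProgram_data_of_inl {p : (edgeProgram var tgt).Node} {s : S}
    (h : tgt p.1 = Sum.inl s) :
    ∃ next, (edgeProgram var tgt).data p = NodeData.query (var s) next ∧
      ∀ b, (next b).1 = some (s, b) := by
  rcases hd : (edgeProgram var tgt).data p with ⟨x, next⟩ | C
  · obtain ⟨s', h1, rfl, h2⟩ := edgeProgram_data_eq_query hd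
    obtain rfl : s = s' := by rw [h] at h1; exact Sum.inl_injective h1
    exact ⟨next, rfl, h2⟩
  · rw [edgeProgram_data_eq_sink hd] at h
    cases h

lemma edgeProgram_edge {p q : (edgeProgram var tgt).Node} {l : Literal α}
    (h : (edgeProgram var tgt).Edge p l q) :
    ∃ s, tgt p.1 = Sum.inl s ∧ l.1 = var s ∧ q.1 = some (s, l.2) := by
  obtain ⟨next, h1, rfl⟩ := h
  obtain ⟨s, h2, h3, h4⟩ := edgeProgram_data_eq_query h1
  exact ⟨s, h2, h3, h4 _⟩

lemma edgeProgram_size_le :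
    (edgeProgram var tgt).size ≤ 2 * Nat.card S + 1 := by
  have := Fintype.ofFinite S
  unfold size
  let := (edgeProgram var tgt).fintypeNode
  rw [← Nat.card_eq_fintype_card]
  refine (Nat.card_le_card_of_injective (Subtype.val : (edgeProgram var tgt).Node → _)
    Subtype.val_injective).trans ?_
  simp [mul_comm]

/-- Along a path the queried variables increase. -/
lemma edgeProgram_path_lt {lt : α → α → Prop}
    (htrans : ∀ {x y z}, lt x y → lt y z → lt x z)
    (hlt : ∀ s b s', tgt (some (s, b)) = Sum.inl s' → lt (var s) (var s'))
    {p q : (edgeProgram var tgt).Node} {A : List (Literal α)}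
    (h : (edgeProgram var tgt).Path p A q) {s' : S} (hq : tgt q.1 = Sum.inl s') :
    (p = q ∧ A = []) ∨ ∃ s, tgt p.1 = Sum.inl s ∧ lt (var s) (var s') := by
  induction h with
  | nil => exact Or.inl ⟨rfl, rfl⟩
  | @cons a b c l A he _ ih =>
    right
    obtain ⟨s, h1, _, h3⟩ := edgeProgram_edge he
    refine ⟨s, h1, ?_⟩
    rcases ih hq with ⟨rfl, rfl⟩ | ⟨s'', h4, h5⟩
    · exact hlt s l.2 s' (h3 ▸ hq)
    · exact htrans (hlt s l.2 s'' (h3 ▸ h4)) h5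

/-- A property of states and sets of literals is carried along paths. -/
lemma edgeProgram_path_induct {Good : S ⊕ Clause α → Set (Literal α) → Prop}
    (hstep : ∀ s b A, Good (Sum.inl s) A → Good (tgt (some (s, b))) (insert (var s, b) A))
    {p q : (edgeProgram var tgt).Node} {A : List (Literal α)}
    (h : (edgeProgram var tgt).Path p A q) (B : Set (Literal α)) (hp : Good (tgt p.1) B) :
    Good (tgt q.1) (B ∪ {l | l ∈ A}) := by
  induction h generalizing B with
  | nil => simpa using hp
  | @cons a b c l A he _ ih =>
    obtain ⟨s, h1, h2, h3⟩ := edgeProgram_edge he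
    have := ih (insert (var s, l.2) B) (h3 ▸ hstep s l.2 B (h1 ▸ hp))
    convert this using 1
    ext m
    have : l = (var s, l.2) := by rw [← h2]
    simp only [Set.mem_union, Set.mem_ofPred_eq, List.mem_cons, Set.mem_insert_iff, ← this]
    tauto

end EdgeProgram

/-- A read-once search strategy with set of states `S` yields a regular resolution refutation of
size at most `2 * |S| + 1`. Here `Inv s A` says that the state `s` describes what is known when the
literals of `A` have been answered. -/
lemma exists_isRegularResolution_of_type {α : Type u} [DecidableEq α] {φ : CNF α} {S : Type}
    [Finite S]
    (var : S → α) (hvar : ∀ s, var s ∈ CNF.vars φ) (lt : α → α → Prop)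
    (htrans : ∀ {x y z}, lt x y → lt y z → lt x z) (hirr : ∀ x, ¬ lt x x)
    (Inv : S → Set (Literal α) → Prop)
    (hstart : (∃ s, Inv s ∅) ∨ ∃ C ∈ φ, ∀ l ∈ C, Literal.neg l ∈ (∅ : Set (Literal α)))
    (hstep : ∀ s b, (∃ s', lt (var s) (var s') ∧ ∀ A, Inv s A → Inv s' (insert (var s, b) A)) ∨
      ∃ C ∈ φ, ∀ A, Inv s A → ∀ l ∈ C, Literal.neg l ∈ insert (var s, b) A) :
    ∃ H : BranchingProgram α, H.IsRegularResolution φ ∧ H.size ≤ 2 * Nat.card S + 1 := by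
  let Good : S ⊕ Clause α → Set (Literal α) → Prop := fun o A =>
    Sum.elim (fun s => Inv s A) (fun C => C ∈ φ ∧ ∀ l ∈ C, Literal.neg l ∈ A) o
  have hstart' : ∃ o, Good o ∅ := by
    rcases hstart with ⟨s, hs⟩ | ⟨C, hC⟩
    · exact ⟨Sum.inl s, hs⟩
    · exact ⟨Sum.inr C, hC⟩
  have hstep' : ∀ s b, ∃ o, (∀ s', o = Sum.inl s' → lt (var s) (var s')) ∧
      (∀ C, o = Sum.inr C → C ∈ φ) ∧ ∀ A, Inv s A → Good o (insert (var s, b) A) := by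
    intro s b
    rcases hstep s b with ⟨s', h1, h2⟩ | ⟨C, hC, h⟩
    · exact ⟨Sum.inl s', by rintro _ ⟨⟩; exact h1, by simp, h2⟩
    · exact ⟨Sum.inr C, by simp, by rintro _ ⟨⟩; exact hC, fun A hA => ⟨hC, h A hA⟩⟩
  obtain ⟨o, ho⟩ := hstart'
  -- The successor is chosen from the state and the answer alone, not from the literals `A`; hence
  -- paths that meet in a state can share their continuation.
  choose step hlt hmem hgood using hstep'
  let tgt : Option (S × Bool) → S ⊕ Clause α := fun p => p.elim o fun e => step e.1 e.2
  have hpath : ∀ {p q : (edgeProgram var tgt).Node} {A : List (Literal α)} {s' : S},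
      (edgeProgram var tgt).Path p A q → tgt q.1 = Sum.inl s' →
      (p = q ∧ A = []) ∨ ∃ s, tgt p.1 = Sum.inl s ∧ lt (var s) (var s') := fun h hq =>
    edgeProgram_path_lt (lt := lt) htrans (fun s b s' h => hlt s b s' h) h hq
  refine ⟨edgeProgram var tgt, ⟨?_, ?_, ?_, ?_, ?_, ?_, ?_⟩, edgeProgram_size_le⟩
  · intro a A h
    cases h with
    | nil => rfl
    | cons he hp =>
      obtain ⟨s, h1, _⟩ := edgeProgram_edge he
      rcases hpath (.cons he hp) h1 with ⟨_, h2⟩ | ⟨s', h2, h3⟩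
      · exact h2
      · rw [h1] at h2
        cases h2
        exact absurd h3 (hirr _)
  · rintro ⟨b, hb⟩
    constructor
    · intro h
      cases hb with
      | root => rfl
      | @edge p s b hp hs =>
        obtain ⟨next, h1, h2⟩ := edgeProgram_data_of_inl (var := var) (p := ⟨p, hp⟩) hs
        exact absurd ⟨next, h1, Subtype.ext (h2 b)⟩ (h ⟨p, hp⟩ (var s, b))
    · rintro ⟨⟩ a l he
      obtain ⟨s, _, _, h⟩ := edgeProgram_edge he
      cases h
  · intro a x next h heq
    obtain ⟨s, _, _, h⟩ := edgeProgram_data_eq_query h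
    have := h true
    rw [heq, h false] at this
    simp at this
  · intro a x next h
    obtain ⟨s, _, rfl, _⟩ := edgeProgram_data_eq_query h
    exact hvar s
  · intro a b A x next next' hp ha hb
    obtain ⟨s, h1, rfl, _⟩ := edgeProgram_data_eq_query ha
    obtain ⟨s', h2, h3, _⟩ := edgeProgram_data_eq_query hb
    rcases hpath hp h2 with ⟨h, _⟩ | ⟨s'', h4, h5⟩
    · exact h
    · rw [h1] at h4
      cases h4
      rw [h3] at h5
      exact absurd h5 (hirr _)
  · rintro ⟨a, ha⟩ C h
    have h := edgeProgram_data_eq_sink h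
    cases ha with
    | root =>
      change o = _ at h
      rw [h] at ho
      exact ho.1
    | @edge p s b hp hs => exact hmem s b C h
  · intro a C A h hp l hl
    have := edgeProgram_path_induct (Good := Good) (fun s b A hA => hgood s b A hA) hp ∅ ho
    rw [edgeProgram_data_eq_sink h] at this
    simpa using this.2 l hl

/-- `exists_isRegularResolution_of_type` for states in an arbitrary universe. -/
lemma exists_isRegularResolution {α : Type u} [DecidableEq α] {φ : CNF α} {S : Type v} [Finite S]
    (var : S → α) (hvar : ∀ s, var s ∈ CNF.vars φ) (lt : α → α → Prop)
    (htrans : ∀ {x y z}, lt x y → lt y z → lt x z) (hirr : ∀ x, ¬ lt x x)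
    (Inv : S → Set (Literal α) → Prop)
    (hstart : (∃ s, Inv s ∅) ∨ ∃ C ∈ φ, ∀ l ∈ C, Literal.neg l ∈ (∅ : Set (Literal α)))
    (hstep : ∀ s b, (∃ s', lt (var s) (var s') ∧ ∀ A, Inv s A → Inv s' (insert (var s, b) A)) ∨
      ∃ C ∈ φ, ∀ A, Inv s A → ∀ l ∈ C, Literal.neg l ∈ insert (var s, b) A) :
    ∃ H : BranchingProgram α, H.IsRegularResolution φ ∧ H.size ≤ 2 * Nat.card S + 1 := by
  obtain ⟨n, ⟨e⟩⟩ := Finite.exists_equiv_fin S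
  rw [Nat.card_congr e]
  exact exists_isRegularResolution_of_type (fun s => var (e.symm s)) (fun s => hvar _) lt
    htrans hirr (fun s => Inv (e.symm s))
    (hstart.imp_left fun ⟨s, hs⟩ => ⟨e s, by simpa using hs⟩)
    (fun s b => (hstep (e.symm s) b).imp_left fun ⟨s', h⟩ => ⟨e s', by simpa using h⟩)

end BranchingProgram
-- Connected sets of nodes in a rooted tree
section Tree

variable {T : RootedTree.{v}}

/-- The ancestors of a node form a chain, so the parent is the largest proper ancestor. -/
lemma _root_.RootedTree.le_of_lt_covBy {r s t : T} (h : r < t) (hst : s ⋖ t) : r ≤ s := by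
  rcases le_total_of_directed hst.le h.le with h1 | h1
  · exact h1
  · rcases h1.eq_or_lt with rfl | h1
    · exact le_rfl
    · exact absurd h (hst.2 h1)

lemma _root_.RootedTree.eq_of_covBy_of_le {r s s' t : T} (h : r ⋖ s) (h' : r ⋖ s') (hs : s ≤ t)
    (hs' : s' ≤ t) : s = s' := by
  rcases le_total_of_directed hs' hs with h1 | h1
  · rcases h1.eq_or_lt with h1 | h1
    · exact h1
    · exact absurd h1 (h'.2 h.lt)
  · rcases h1.eq_or_lt with h1 | h1
    · exact h1.symm
    · exact absurd h1 (h.2 h'.lt)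

/-- A set of nodes that is connected in the tree and contains a node above `s` and a node that is
not above `s` contains `s` and its parent. -/
lemma mem_of_connected_of_not_le {X : Set T} (hX : ((SimpleGraph.hasse T).induce X).Connected)
    {r s t : T} (ht : t ∈ X) (hr : r ∈ X) (hst : s ≤ t) (hsr : ¬ s ≤ r) :
    s ∈ X ∧ ∃ q ∈ X, q ⋖ s := by
  obtain ⟨w⟩ := hX.preconnected ⟨t, ht⟩ ⟨r, hr⟩
  generalize ha : (⟨t, ht⟩ : X) = a at w
  generalize hb : (⟨r, hr⟩ : X) = b at w
  have hsa : s ≤ a.1 := by rw [← ha]; exact hst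
  have hsb : ¬ s ≤ b.1 := by rw [← hb]; exact hsr
  clear ha hb
  induction w with
  | nil => exact absurd hsa hsb
  | @cons a b c h w ih =>
    by_cases h1 : s ≤ b.1
    · exact ih h1 hsb
    -- Here the walk leaves the subtree of `s`; the only edge doing so joins `s` to its parent.
    · have h2 : a.1 ⋖ b.1 ∨ b.1 ⋖ a.1 := h
      rcases h2 with h2 | h2
      · exact absurd (hsa.trans h2.le) h1
      · rcases hsa.eq_or_lt with rfl | h3
        · exact ⟨a.2, b.1, b.2, h2⟩
        · exact absurd (RootedTree.le_of_lt_covBy h3 h2) h1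

lemma mem_of_connected_of_le_of_le {X : Set T} (hX : ((SimpleGraph.hasse T).induce X).Connected)
    {r s t : T} (hr : r ∈ X) (ht : t ∈ X) (hrs : r ≤ s) (hst : s ≤ t) : s ∈ X := by
  by_cases h : s ≤ r
  · rwa [le_antisymm h hrs]
  · exact (mem_of_connected_of_not_le hX ht hr hst h).1

lemma exists_isLeast_of_connected [Finite T] {X : Set T}
    (hX : ((SimpleGraph.hasse T).induce X).Connected) : ∃ m, IsLeast X m := by
  obtain ⟨⟨m₀, hm₀⟩⟩ := hX.nonempty
  obtain ⟨m, hm, hmin⟩ := (Set.toFinite X).exists_minimal ⟨m₀, hm₀⟩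
  refine ⟨m, hm, fun t ht => ?_⟩
  by_contra h
  -- If `m` were minimal but not least, its parent would lie in `X`.
  obtain ⟨_, q, hq, hqm⟩ := mem_of_connected_of_not_le hX hm ht le_rfl h
  exact hqm.lt.not_ge (hmin hq hqm.le)

end Tree
-- Bags, topmost nodes and the query order
namespace TreeDecomposition

variable {α : Type u} [DecidableEq α] {φ : CNF α} {T : RootedTree.{v}}
  (D : TreeDecomposition (CNF.incidenceGraph φ) T)

/-- The variable `y` of `φ` is in the bag of `t`. -/
def VarMem (t : T) (y : α) : Prop := ∃ h : y ∈ CNF.vars φ, Sum.inl ⟨y, h⟩ ∈ D.bag t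

/-- The clause `C` of `φ` is in the bag of `t`. -/
def ClauseMem (t : T) (C : Clause α) : Prop := ∃ h : C ∈ φ, Sum.inr ⟨C, h⟩ ∈ D.bag t

variable {D}

lemma VarMem.of_le_of_le {r s t : T} {y : α} (hr : D.VarMem r y) (ht : D.VarMem t y)
    (hrs : r ≤ s) (hst : s ≤ t) : D.VarMem s y :=
  ⟨hr.1, mem_of_connected_of_le_of_le (D.connectivity _) hr.2 ht.2 hrs hst⟩

lemma ClauseMem.of_le_of_le {r s t : T} {C : Clause α} (hr : D.ClauseMem r C)
    (ht : D.ClauseMem t C) (hrs : r ≤ s) (hst : s ≤ t) : D.ClauseMem s C :=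
  ⟨hr.1, mem_of_connected_of_le_of_le (D.connectivity _) hr.2 ht.2 hrs hst⟩

/-- The only consequence of one-sidedness that the proof needs. -/
lemma IsOneSided.le_total (hD : D.IsOneSided) {s t : T} {C : Clause α} (hs : D.ClauseMem s C)
    (ht : D.ClauseMem t C) : s ≤ t ∨ t ≤ s := by
  obtain ⟨p, hp, hmem⟩ := hD ⟨C, hs.1⟩
  have hp : p.Pairwise (· < ·) := (hp.imp fun _ _ h => CovBy.lt h).pairwise
  have hp : p.Pairwise fun s t => s ≤ t ∨ t ≤ s := hp.imp fun h => Or.inl h.le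
  have : Std.Symm fun s t : T => s ≤ t ∨ t ≤ s := ⟨fun _ _ => Or.symm⟩
  exact List.Pairwise.forall_of_forall (R := fun s t : T => s ≤ t ∨ t ≤ s)
    (fun _ _ => Or.inl le_rfl) hp ((hmem s).2 hs.2) ((hmem t).2 ht.2)

lemma exists_clauseMem (D : TreeDecomposition (CNF.incidenceGraph φ) T) {C : Clause α}
    (hC : C ∈ φ) : ∃ t, D.ClauseMem t C := by
  obtain ⟨t, ht⟩ := D.union (Sum.inr ⟨C, hC⟩)
  exact ⟨t, hC, ht⟩

lemma mem_vars {C : Clause α} (hC : C ∈ φ) {l : Literal α} (hl : l ∈ C) : l.1 ∈ CNF.vars φ :=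
  Finset.mem_biUnion.2 ⟨C, hC, Finset.mem_image_of_mem _ hl⟩

lemma exists_varMem_clauseMem (D : TreeDecomposition (CNF.incidenceGraph φ) T) {C : Clause α}
    (hC : C ∈ φ) {l : Literal α} (hl : l ∈ C) : ∃ t, D.VarMem t l.1 ∧ D.ClauseMem t C := by
  obtain ⟨t, h1, h2⟩ := D.containment (Sum.inl ⟨l.1, mem_vars hC hl⟩) (Sum.inr ⟨C, hC⟩)
    ⟨by simp, Or.inl ⟨⟨l.1, mem_vars hC hl⟩, ⟨C, hC⟩, rfl, rfl, l, hl, rfl⟩⟩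
  exact ⟨t, ⟨_, h1⟩, ⟨_, h2⟩⟩

lemma exists_isLeast_varMem [Finite T] (D : TreeDecomposition (CNF.incidenceGraph φ) T) (y : α) :
    ∃ t : T, y ∈ CNF.vars φ → IsLeast {t | D.VarMem t y} t := by
  by_cases hy : y ∈ CNF.vars φ
  · obtain ⟨t, h1, h2⟩ := exists_isLeast_of_connected (D.connectivity (Sum.inl ⟨y, hy⟩))
    exact ⟨t, fun _ => ⟨⟨hy, h1⟩, fun s hs => h2 hs.2⟩⟩
  · exact ⟨⊥, fun h => absurd h hy⟩

/-- The topmost node whose bag contains the variable `y`. -/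
noncomputable def top [Finite T] (D : TreeDecomposition (CNF.incidenceGraph φ) T) (y : α) : T :=
  (D.exists_isLeast_varMem y).choose

section Top

variable [Finite T]

lemma varMem_top {y : α} (hy : y ∈ CNF.vars φ) : D.VarMem (D.top y) y :=
  ((D.exists_isLeast_varMem y).choose_spec hy).1

lemma VarMem.top_le {t : T} {y : α} (h : D.VarMem t y) : D.top y ≤ t :=
  ((D.exists_isLeast_varMem y).choose_spec h.1).2 h

variable (D)

/-- The variable `x` is queried before the variable `y`: its topmost node is above that of `y`, or
the two nodes are the same and `x` comes first in the numbering `e`. -/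
def QueriedBefore (e : α → ℕ) (x y : α) : Prop :=
  D.top x < D.top y ∨ D.top x = D.top y ∧ e x < e y

/-- The variables in the bag of `D.top x` whose values are known when `x` is queried. -/
def known (e : α → ℕ) (x : α) : Set α := {y | D.VarMem (D.top x) y ∧ D.QueriedBefore e y x}

end Top

/-! ### Residual formulas and the descent to a child -/

variable (D)

/-- The clauses below `t`, without those of the bag of `t` that are in `U`, and restricted to the
variables below `t`, have no common satisfying assignment that agrees with `ρ` on `K`. -/
def ResidualUnsat (t : T) (K : Set α) (ρ : α → Bool) (U : Set (Clause α)) : Prop :=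
  ∀ a : α → Bool, (∀ y ∈ K, a y = ρ y) → ∃ C, (∃ s, t ≤ s ∧ D.ClauseMem s C) ∧
    ¬ (D.ClauseMem t C ∧ C ∈ U) ∧ ∀ l ∈ C, (∃ s, t ≤ s ∧ D.VarMem s l.1) → a l.1 ≠ l.2

/-- The literals in `A` set the variables of `K` according to `ρ`, and they falsify what the nodes
above `t` contain of the clauses of `ResidualUnsat`. -/
def Records (t : T) (K : Set α) (ρ : α → Bool) (U : Set (Clause α)) (A : Set (Literal α)) :
    Prop :=
  (∀ y ∈ K, (y, ρ y) ∈ A) ∧ ∀ C, (∃ s, t ≤ s ∧ D.ClauseMem s C) → ¬ (D.ClauseMem t C ∧ C ∈ U) →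
    ∀ l ∈ C, ∀ r < t, D.VarMem r l.1 → D.ClauseMem r C → Literal.neg l ∈ A

variable {D}

/-- Only `ρ` on `K` and `U` within the bag of `t` matter, which allows both to be coded by a subset
of the bag. -/
lemma ResidualUnsat.congr {t : T} {K : Set α} {ρ ρ' : α → Bool} {U U' : Set (Clause α)}
    (h : D.ResidualUnsat t K ρ U) (hρ : ∀ y ∈ K, ρ' y = ρ y)
    (hU : ∀ C, D.ClauseMem t C → (C ∈ U' ↔ C ∈ U)) : D.ResidualUnsat t K ρ' U' := by
  intro a ha
  obtain ⟨C, h1, h2, h3⟩ := h a fun y hy => (ha y hy).trans (hρ y hy)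
  exact ⟨C, h1, fun h => h2 ⟨h.1, (hU C h.1).1 h.2⟩, h3⟩

lemma Records.congr {t : T} {K : Set α} {ρ ρ' : α → Bool} {U U' : Set (Clause α)}
    {A : Set (Literal α)} (h : D.Records t K ρ U A) (hρ : ∀ y ∈ K, ρ' y = ρ y)
    (hU : ∀ C, D.ClauseMem t C → (C ∈ U' ↔ C ∈ U)) : D.Records t K ρ' U' A :=
  ⟨fun y hy => by rw [hρ y hy]; exact h.1 y hy,
    fun C hC hCU => h.2 C hC fun h => hCU ⟨h.1, (hU C h.1).2 h.2⟩⟩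

/-- The clauses of `U` and those with a literal that is true under `ρ` and whose variable is in the
bag of `t`. -/
def satisfied (D : TreeDecomposition (CNF.incidenceGraph φ) T) (t : T) (ρ : α → Bool)
    (U : Set (Clause α)) : Set (Clause α) :=
  {C | D.ClauseMem t C ∧ (C ∈ U ∨ ∃ l ∈ C, D.VarMem t l.1 ∧ ρ l.1 = l.2)}

/-- Makes gluing possible: variables shared by the subtrees of two children are already fixed at the
parent. -/
lemma VarMem.of_covBy {t t' t'' s s' : T} {y : α} (ht' : t ⋖ t') (ht'' : t ⋖ t'') (hs : t' ≤ s)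
    (hs' : t'' ≤ s') (h : D.VarMem s y) (h' : D.VarMem s' y) (hne : t' ≠ t'') : D.VarMem t y := by
  have hn : ¬ t' ≤ s' := fun hle => hne (RootedTree.eq_of_covBy_of_le ht' ht'' hle hs')
  obtain ⟨_, q, hq, hqt⟩ := mem_of_connected_of_not_le (D.connectivity _) h.2 h'.2 hs hn
  obtain rfl : q = t := le_antisymm (RootedTree.le_of_lt_covBy hqt.lt ht')
    (RootedTree.le_of_lt_covBy ht'.lt hqt)
  exact ⟨h.1, hq⟩

/-- If the residual formula at `t` is unsatisfiable and all the variables of the bag of `t` are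
known, then a clause that ends at `t` is falsified or the residual formula at a child of `t` is
unsatisfiable. -/
lemma ResidualUnsat.exists_child [Finite T] {t : T} {ρ : α → Bool} {U : Set (Clause α)}
    (h : D.ResidualUnsat t {y | D.VarMem t y} ρ U) :
    (∃ C, D.ClauseMem t C ∧ C ∉ D.satisfied t ρ U ∧ ∀ s, t < s → ¬ D.ClauseMem s C) ∨
    ∃ t', t ⋖ t' ∧
      D.ResidualUnsat t' {y | D.VarMem t y ∧ D.VarMem t' y} ρ (D.satisfied t ρ U) := by
  classical
  by_contra hcon
  obtain ⟨h1, h2⟩ := not_or.1 hcon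
  have hchild : ∀ t', t ⋖ t' → ∃ a : α → Bool,
      (∀ y, D.VarMem t y → D.VarMem t' y → a y = ρ y) ∧
      ∀ C, (∃ s, t' ≤ s ∧ D.ClauseMem s C) → ¬ (D.ClauseMem t' C ∧ C ∈ D.satisfied t ρ U) →
        ∃ l ∈ C, (∃ s, t' ≤ s ∧ D.VarMem s l.1) ∧ a l.1 = l.2 := by
    intro t' ht'
    by_contra hno
    refine h2 ⟨t', ht', fun a ha => ?_⟩
    by_contra hC
    refine hno ⟨a, fun y hy hy' => ha y ⟨hy, hy'⟩, fun C hs hn => ?_⟩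
    by_contra hl
    exact hC ⟨C, hs, hn, fun l hlC hls heq => hl ⟨l, hlC, hls, heq⟩⟩
  choose! a hρ ha using hchild
  -- The glued assignment. Outside the bag of `t` a variable occurs below at most one child, so the
  -- choice of child is harmless; the value `true` is used only for variables not occurring below
  -- `t` at all.
  let b : α → Bool := fun y => if D.VarMem t y then ρ y else
    if h : ∃ t', t ⋖ t' ∧ ∃ s, t' ≤ s ∧ D.VarMem s y then a h.choose y else true
  have hb : ∀ y, D.VarMem t y → b y = ρ y := fun y hy => if_pos hy
  have hba : ∀ t', t ⋖ t' → ∀ s, t' ≤ s → ∀ y, D.VarMem s y → b y = a t' y := by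
    intro t' ht' s hs y hy
    by_cases hyt : D.VarMem t y
    · rw [hb y hyt, hρ t' ht' y hyt (hyt.of_le_of_le hy ht'.le hs)]
    · have hex : ∃ t', t ⋖ t' ∧ ∃ s, t' ≤ s ∧ D.VarMem s y := ⟨t', ht', s, hs, hy⟩
      have heq : b y = a hex.choose y := by simp only [b, if_neg hyt, dif_pos hex]
      obtain ⟨ht'', s', hs', hy'⟩ := hex.choose_spec
      rw [heq]
      by_contra hne
      exact hyt (VarMem.of_covBy ht' ht'' hs hs' hy hy' fun h => hne (by rw [← h]))
  obtain ⟨C, ⟨s, hts, hs⟩, hnU, hfalse⟩ := h b hb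
  have hsat : ¬ (D.ClauseMem t C ∧ C ∈ D.satisfied t ρ U) := by
    rintro ⟨hC, -, hU | ⟨l, hl, hlt, heq⟩⟩
    · exact hnU ⟨hC, hU⟩
    · exact hfalse l hl ⟨t, le_rfl, hlt⟩ ((hb _ hlt).trans heq)
  -- The clause falsified by `b` does not end at `t`, so some child's assignment satisfies it, and
  -- `b` agrees with that assignment below the child.
  obtain ⟨s', hts', hs'⟩ : ∃ s', t < s' ∧ D.ClauseMem s' C := by
    rcases hts.eq_or_lt with rfl | hlt
    · by_contra hno
      exact h1 ⟨C, hs, fun h => hsat ⟨hs, h⟩, fun s' h h' => hno ⟨s', h, h'⟩⟩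
    · exact ⟨s, hlt, hs⟩
  obtain ⟨t', ht', hle⟩ := exists_covBy_le_of_lt hts'
  obtain ⟨l, hl, ⟨r, hr, hlr⟩, heq⟩ := ha t' ht' C ⟨s', hle, hs'⟩ fun h => hsat ⟨h.2.1, h.2⟩
  exact hfalse l hl ⟨r, ht'.le.trans hr, hlr⟩ ((hba t' ht' r hr _ hlr).trans heq)

/-- Literals met at `t` are false under `ρ` because `C` is not satisfied there; those met strictly
above `t` were recorded earlier. -/
lemma Records.neg_mem {t : T} {ρ : α → Bool} {U : Set (Clause α)} {A : Set (Literal α)}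
    (h : D.Records t {y | D.VarMem t y} ρ U A) {C : Clause α} (hC : D.ClauseMem t C)
    (hCU : C ∉ D.satisfied t ρ U) {l : Literal α} (hl : l ∈ C) {r : T} (hr : r ≤ t)
    (hlr : D.VarMem r l.1) (hCr : D.ClauseMem r C) : Literal.neg l ∈ A := by
  rcases hr.eq_or_lt with rfl | hr
  · have hne : ρ l.1 ≠ l.2 := fun heq => hCU ⟨hC, Or.inr ⟨l, hl, hlr, heq⟩⟩
    have := h.1 l.1 hlr
    rwa [Bool.eq_not_of_ne hne] at this
  · exact h.2 C ⟨t, le_rfl, hC⟩ (fun h => hCU ⟨hC, Or.inl h.2⟩) l hl r hr hlr hCr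

/-- A clause occurring both above and below the edge from `t` to `t'` lies in the bag of `t`, by
connectivity, so `Records.neg_mem` applies to it. -/
lemma Records.of_covBy {t t' : T} (htt : t ⋖ t') {ρ : α → Bool} {U : Set (Clause α)}
    {A : Set (Literal α)} (h : D.Records t {y | D.VarMem t y} ρ U A) :
    D.Records t' {y | D.VarMem t y ∧ D.VarMem t' y} ρ (D.satisfied t ρ U) A := by
  refine ⟨fun y hy => h.1 y hy.1, ?_⟩
  rintro C ⟨s, hs, hCs⟩ hn l hl r hr hlr hCr
  have hrt := RootedTree.le_of_lt_covBy hr htt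
  have hCt : D.ClauseMem t C := hCr.of_le_of_le hCs hrt (htt.le.trans hs)
  exact h.neg_mem hCt (fun h => hn ⟨hCt.of_le_of_le hCs htt.le hs, h⟩) hl hrt hlr hCr

lemma Records.neg_mem_of_isOneSided (hD : D.IsOneSided) {t : T} {ρ : α → Bool}
    {U : Set (Clause α)} {A : Set (Literal α)} (h : D.Records t {y | D.VarMem t y} ρ U A)
    {C : Clause α} (hC : D.ClauseMem t C) (hCU : C ∉ D.satisfied t ρ U)
    (hend : ∀ s, t < s → ¬ D.ClauseMem s C) {l : Literal α} (hl : l ∈ C) :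
    Literal.neg l ∈ A := by
  obtain ⟨r, hlr, hCr⟩ := D.exists_varMem_clauseMem hC.1 hl
  have hrt : r ≤ t := by
    rcases hD.le_total hCr hC with hle | hle
    · exact hle
    · rcases hle.eq_or_lt with rfl | hlt
      · exact le_rfl
      · exact absurd hCr (hend r hlt)
  exact h.neg_mem hC hCU hl hrt hlr hCr

/-! ### Finding the next variable to query -/

section Query

variable [Finite T] {e : α → ℕ}

/-- From a node with an unsatisfiable residual formula one can descend to a node where a new
variable is to be queried, or to a node where a clause is falsified. -/
lemma ResidualUnsat.exists_query (hD : D.IsOneSided) (he : Set.InjOn e (CNF.vars φ)) (t : T) :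
    ∀ (K : Set α) (ρ : α → Bool) (U : Set (Clause α)),
      (∀ y ∈ K, D.VarMem t y) → (∀ y, D.VarMem t y → D.top y < t → y ∈ K) →
      (∀ x y, x ∈ K → D.VarMem t y → D.QueriedBefore e y x → y ∈ K) →
      D.ResidualUnsat t K ρ U →
      (∃ x ∈ CNF.vars φ, t ≤ D.top x ∧ x ∉ K ∧ ∃ (ρ' : α → Bool) (U' : Set (Clause α)),
        D.ResidualUnsat (D.top x) (D.known e x) ρ' U' ∧
        ∀ A, D.Records t K ρ U A → D.Records (D.top x) (D.known e x) ρ' U' A) ∨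
      ∃ C ∈ φ, ∀ A, D.Records t K ρ U A → ∀ l ∈ C, Literal.neg l ∈ A := by
  -- Induction from the leaves upwards: the claim at `t` may use its children.
  induction t using WellFoundedGT.induction with | ind t ih
  intro K ρ U hK hold hdown hU
  by_cases hex : ∃ y, D.VarMem t y ∧ y ∉ K
  · left
    let P : ℕ → Prop := fun n => ∃ y, D.VarMem t y ∧ y ∉ K ∧ e y = n
    have hP : ∃ n, P n := hex.elim fun y hy => ⟨e y, y, hy.1, hy.2, rfl⟩
    classical
    obtain ⟨x, hx, hxK, hxe⟩ := Nat.find_spec hP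
    have hmin : ∀ y, D.VarMem t y → e y < e x → y ∈ K := by
      intro y hy hlt
      by_contra hyK
      exact Nat.find_min hP (hxe ▸ hlt) ⟨y, hy, hyK, rfl⟩
    -- A bag variable whose topmost node is strictly above `t` is already in `K`.
    have htop : D.top x = t := by
      by_contra hne
      exact hxK (hold x hx (lt_of_le_of_ne hx.top_le hne))
    -- Since `K` is closed under earlier bag variables and `x` is the first one missing, `K` is
    -- exactly what precedes `x`.
    have hknown : D.known e x = K := by
      ext y
      simp only [known, htop, Set.mem_ofPred_eq, QueriedBefore]
      constructor
      · rintro ⟨hy, hlt | ⟨_, hlt⟩⟩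
        · exact hold y hy hlt
        · exact hmin y hy hlt
      · intro hy
        refine ⟨hK y hy, (hK y hy).top_le.lt_or_eq.imp_right fun hyt => ⟨hyt, ?_⟩⟩
        by_contra hlt
        rcases (not_lt.1 hlt).eq_or_lt with heq | hlt
        · exact hxK (he hx.1 (hK y hy).1 heq ▸ hy)
        · exact hxK (hdown y x hy hx (Or.inr ⟨htop.trans hyt.symm, hlt⟩))
    refine ⟨x, hx.1, htop.ge, hxK, ρ, U, ?_, ?_⟩
    · rwa [hknown, htop]
    · intro A hA
      rwa [hknown, htop]
  · obtain rfl : K = {y | D.VarMem t y} := by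
      ext y
      exact ⟨hK y, fun hy => by_contra fun hyK => hex ⟨y, hy, hyK⟩⟩
    rcases hU.exists_child with ⟨C, hC, hCU, hend⟩ | ⟨t', ht', hU'⟩
    · exact Or.inr ⟨C, hC.1, fun A hA l hl => hA.neg_mem_of_isOneSided hD hC hCU hend hl⟩
    · rcases ih t' ht'.lt {y | D.VarMem t y ∧ D.VarMem t' y} ρ (D.satisfied t ρ U) (fun y hy => hy.2)
        (fun y hy hyt => ⟨(varMem_top hy.1).of_le_of_le hy
          (RootedTree.le_of_lt_covBy hyt ht') ht'.le, hy⟩)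
        (fun x y hx hy hyx => ⟨(varMem_top hy.1).of_le_of_le hy
          ((hyx.elim le_of_lt fun h => h.1.le).trans hx.1.top_le) ht'.le, hy⟩) hU'
        with ⟨x, hx, hxt, hxK, ρ', U', h1, h2⟩ | ⟨C, hC, h⟩
      · exact Or.inl ⟨x, hx, ht'.le.trans hxt,
          fun hxt' => (ht'.lt.trans_le hxt).not_ge (VarMem.top_le hxt'), ρ', U', h1,
          fun A hA => h2 A (hA.of_covBy ht')⟩
      · exact Or.inr ⟨C, hC, fun A hA => h A (hA.of_covBy ht')⟩

lemma QueriedBefore.trans {x y z : α} (h : D.QueriedBefore e x y) (h' : D.QueriedBefore e y z) :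
    D.QueriedBefore e x z := by
  rcases h with h | ⟨h1, h2⟩ <;> rcases h' with h' | ⟨h1', h2'⟩
  · exact Or.inl (h.trans h')
  · exact Or.inl (h1' ▸ h)
  · exact Or.inl (h1 ▸ h')
  · exact Or.inr ⟨h1.trans h1', h2.trans h2'⟩

lemma not_queriedBefore_self (x : α) : ¬ D.QueriedBefore e x x := fun h =>
  h.elim (lt_irrefl _) fun h => lt_irrefl _ h.2

/-- The search starts at the root of the tree with nothing known, where the residual formula is `φ`
itself. -/
lemma exists_query_of_unsatisfiable (hD : D.IsOneSided) (he : Set.InjOn e (CNF.vars φ))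
    (hφ : φ.Unsatisfiable) :
    (∃ x ∈ CNF.vars φ, ∃ (ρ : α → Bool) (U : Set (Clause α)),
      D.ResidualUnsat (D.top x) (D.known e x) ρ U ∧
      D.Records (D.top x) (D.known e x) ρ U ∅) ∨
    ∃ C ∈ φ, ∀ l ∈ C, Literal.neg l ∈ (∅ : Set (Literal α)) := by
  have hR : D.Records ⊥ ∅ (fun _ => true) ∅ ∅ :=
    ⟨fun y hy => absurd hy (Set.notMem_empty y), fun C _ _ l _ r hr => absurd hr not_lt_bot⟩
  rcases ResidualUnsat.exists_query hD he ⊥ ∅ (fun _ => true) ∅ (by simp) (by simp) (by simp)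
    (fun a _ => by
      by_contra hno
      refine hφ ⟨a, fun C hC => ?_⟩
      by_contra hl
      obtain ⟨s, hs⟩ := D.exists_clauseMem hC
      exact hno ⟨C, ⟨s, bot_le, hs⟩, by simp, fun l hlC _ heq => hl ⟨l, hlC, heq⟩⟩) with
    ⟨x, hx, _, _, ρ, U, h1, h2⟩ | ⟨C, hC, h⟩
  · exact Or.inl ⟨x, hx, ρ, U, h1, h2 _ hR⟩
  · exact Or.inr ⟨C, hC, h _ hR⟩

/-- The answer adds `x` to the known variables, and the descent resumes from the same node. -/
lemma ResidualUnsat.exists_query_of_answer (hD : D.IsOneSided) (he : Set.InjOn e (CNF.vars φ))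
    {x : α} (hx : x ∈ CNF.vars φ) {ρ : α → Bool} {U : Set (Clause α)}
    (hU : D.ResidualUnsat (D.top x) (D.known e x) ρ U) (b : Bool) :
    (∃ x' ∈ CNF.vars φ, D.QueriedBefore e x x' ∧ ∃ (ρ' : α → Bool) (U' : Set (Clause α)),
      D.ResidualUnsat (D.top x') (D.known e x') ρ' U' ∧
      ∀ A, D.Records (D.top x) (D.known e x) ρ U A →
        D.Records (D.top x') (D.known e x') ρ' U' (insert (x, b) A)) ∨
    ∃ C ∈ φ, ∀ A, D.Records (D.top x) (D.known e x) ρ U A →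
      ∀ l ∈ C, Literal.neg l ∈ insert (x, b) A := by
  have hρ : ∀ y ∈ D.known e x, Function.update ρ x b y = ρ y := fun y hy =>
    Function.update_of_ne (by rintro rfl; exact not_queriedBefore_self _ hy.2) _ _
  have hR : ∀ A, D.Records (D.top x) (D.known e x) ρ U A →
      D.Records (D.top x) (insert x (D.known e x)) (Function.update ρ x b) U
        (insert (x, b) A) := by
    intro A hA
    refine ⟨?_, fun C h1 h2 l hl r hr h3 h4 => Or.inr (hA.2 C h1 h2 l hl r hr h3 h4)⟩
    rintro y (rfl | hy)
    · left
      simp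
    · right
      rw [hρ y hy]
      exact hA.1 y hy
  rcases ResidualUnsat.exists_query hD he (D.top x) (insert x (D.known e x))
    (Function.update ρ x b) U
    (by
      rintro y (rfl | hy)
      · exact varMem_top hx
      · exact hy.1)
    (fun y hy hlt => Or.inr ⟨hy, Or.inl hlt⟩)
    (by
      rintro z y (rfl | hz) hy hyz
      · exact Or.inr ⟨hy, hyz⟩
      · exact Or.inr ⟨hy, hyz.trans hz.2⟩)
    (fun a ha => hU a fun y hy => (ha y (Or.inr hy)).trans (hρ y hy)) with
    ⟨x', hx', hle, hK, ρ', U', h1, h2⟩ | ⟨C, hC, h⟩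
  · refine Or.inl ⟨x', hx', ?_, ρ', U', h1, fun A hA => h2 _ (hR A hA)⟩
    rcases hle.lt_or_eq with hlt | heq
    · exact Or.inl hlt
    -- With the same topmost node, a variable numbered no later than `x` would already be known.
    · refine Or.inr ⟨heq, ?_⟩
      by_contra hlt
      rcases (not_lt.1 hlt).eq_or_lt with hee | hlt
      · exact hK (Or.inl (he hx' hx hee))
      · exact hK (Or.inr ⟨heq ▸ varMem_top hx', Or.inr ⟨heq.symm, hlt⟩⟩)
  · exact Or.inr ⟨C, hC, fun A hA => h _ (hR A hA)⟩

end Query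

/-! ### Coding states by subsets of bags, and the size bound -/

section Coding

open Classical in
/-- The assignment that is true on the variables in `F`. -/
noncomputable def codedAssignment
    (F : Finset ({x : α // x ∈ CNF.vars φ} ⊕ {C : Clause α // C ∈ φ})) (y : α) : Bool :=
  decide (∃ h : y ∈ CNF.vars φ, Sum.inl ⟨y, h⟩ ∈ F)

/-- The clauses in `F`. -/
def codedClauses (F : Finset ({x : α // x ∈ CNF.vars φ} ⊕ {C : Clause α // C ∈ φ})) :
    Set (Clause α) :=
  {C | ∃ h : C ∈ φ, Sum.inr ⟨C, h⟩ ∈ F}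

/-- The subset of a bag without `x` codes what has to be known of `ρ` and `U` when `x` is
queried. -/
lemma exists_code [Finite T] (D : TreeDecomposition (CNF.incidenceGraph φ) T) (e : α → ℕ)
    (x : {x : α // x ∈ CNF.vars φ}) (ρ : α → Bool) (U : Set (Clause α)) :
    ∃ F ∈ ((D.bag (D.top x.1)).erase (Sum.inl x)).powerset,
      (∀ y ∈ D.known e x, codedAssignment F y = ρ y) ∧
      ∀ C, D.ClauseMem (D.top x.1) C → (C ∈ codedClauses F ↔ C ∈ U) := by
  classical
  refine ⟨((D.bag (D.top x.1)).erase (Sum.inl x)).filter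
    (Sum.elim (fun y => ρ y.1 = true) fun C => C.1 ∈ U),
    Finset.mem_powerset.2 (Finset.filter_subset _ _), ?_, ?_⟩
  · rintro y ⟨⟨hy, hmem⟩, hyx⟩
    have hne : y ≠ x.1 := by
      rintro rfl
      exact not_queriedBefore_self _ hyx
    have hne : (⟨y, hy⟩ : {x : α // x ∈ CNF.vars φ}) ≠ x := fun h => hne (congrArg Subtype.val h)
    cases hb : ρ y <;> simp [codedAssignment, hy, hmem, hne, hb]
  · rintro C ⟨hC, hmem⟩
    simp [codedClauses, hC, hmem]

end Coding

/-- An unsatisfiable CNF with a one-sided tree decomposition whose bags have at most `k + 1`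
elements has a regular resolution refutation of size at most `2 * (n * 2 ^ k) + 1`. -/
theorem IsOneSided.exists_isRegularResolution [Finite T] (hD : D.IsOneSided)
    (hφ : φ.Unsatisfiable) {k : ℕ} (hk : ∀ t, (D.bag t).card ≤ k + 1) :
    ∃ H : BranchingProgram α, H.IsRegularResolution φ ∧
      H.size ≤ 2 * ((CNF.vars φ).card * 2 ^ k) + 1 := by
  obtain ⟨e, he⟩ : ∃ e : α → ℕ, Set.InjOn e (CNF.vars φ) :=
    Set.countable_iff_exists_injOn.1 (CNF.vars φ).finite_toSet.countable
  let Q := Σ x : {x : α // x ∈ CNF.vars φ},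
    {F // F ∈ ((D.bag (D.top x.1)).erase (Sum.inl x)).powerset}
  let S := {q : Q // D.ResidualUnsat (D.top q.1.1) (D.known e q.1.1)
    (codedAssignment q.2.1) (codedClauses q.2.1)}
  have hQ : Nat.card S ≤ (CNF.vars φ).card * 2 ^ k := by
    refine (Nat.card_le_card_of_injective (Subtype.val : S → Q) Subtype.val_injective).trans ?_
    rw [Nat.card_eq_fintype_card, Fintype.card_sigma]
    refine (Finset.sum_le_card_nsmul _ _ (2 ^ k) fun x _ => ?_).trans_eq ?_
    · rw [Fintype.card_coe, Finset.card_powerset,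
        -- Since `x` belongs to the bag of its topmost node, removing it leaves at most `k` elements
        -- to code.
        Finset.card_erase_of_mem (varMem_top x.2).2]
      exact Nat.pow_le_pow_right two_pos (Nat.sub_le_of_le_add (hk _))
    · simp
  obtain ⟨H, hH, hsize⟩ := BranchingProgram.exists_isRegularResolution
    (φ := φ) (S := S) (fun s => s.1.1.1) (fun s => s.1.1.2) (D.QueriedBefore e)
    (fun h h' => h.trans h') (fun x => not_queriedBefore_self x)
    (fun s A => D.Records (D.top s.1.1.1) (D.known e s.1.1.1) (codedAssignment s.1.2.1)
      (codedClauses s.1.2.1) A)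
    ((exists_query_of_unsatisfiable hD he hφ).imp_left fun ⟨x, hx, ρ, U, h1, h2⟩ => by
      obtain ⟨F, hF, hρ, hU⟩ := D.exists_code e ⟨x, hx⟩ ρ U
      exact ⟨⟨⟨⟨x, hx⟩, F, hF⟩, h1.congr hρ hU⟩, h2.congr hρ hU⟩)
    (fun s b => (s.2.exists_query_of_answer hD he s.1.1.2 b).imp_left
      fun ⟨x, hx, hlt, ρ, U, h1, h2⟩ => by
        obtain ⟨F, hF, hρ, hU⟩ := D.exists_code e ⟨x, hx⟩ ρ U
        exact ⟨⟨⟨⟨x, hx⟩, F, hF⟩, h1.congr hρ hU⟩, hlt, fun A hA => (h2 A hA).congr hρ hU⟩)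
  exact ⟨H, hH, hsize.trans (by gcongr)⟩

lemma card_bag_le_width_add_one {V : Type u} {G : SimpleGraph V} [Fintype T]
    (D : TreeDecomposition G T) (t : T) : (D.bag t).card ≤ D.width + 1 := by
  have : (D.bag t).card ≤ Finset.univ.sup fun t : T => (D.bag t).card :=
    Finset.le_sup (f := fun t : T => (D.bag t).card) (Finset.mem_univ t)
  unfold width
  lia

theorem IsOneSided.exists_isRegularResolution_of_width [Fintype T] (hD : D.IsOneSided)
    (hφ : φ.Unsatisfiable) :
    ∃ H : BranchingProgram α, H.IsRegularResolution φ ∧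
      H.size ≤ 3 * 4 ^ D.width * max (CNF.vars φ).card 1 := by
  obtain ⟨H, hH, hsize⟩ := hD.exists_isRegularResolution hφ D.card_bag_le_width_add_one
  refine ⟨H, hH, hsize.trans ?_⟩
  -- The extra root vertex is absorbed by `max n 1`, which also covers `n = 0`; the base `2` is
  -- weakened to `4`.
  calc 2 * ((CNF.vars φ).card * 2 ^ D.width) + 1
      ≤ 2 * (max (CNF.vars φ).card 1 * 4 ^ D.width) + max (CNF.vars φ).card 1 * 4 ^ D.width := by
        refine add_le_add (Nat.mul_le_mul_left _ (Nat.mul_le_mul (le_max_left _ _)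
          (Nat.pow_le_pow_left (by lia) _))) ?_
        exact Nat.mul_pos (by simp) (by positivity)
    _ = 3 * 4 ^ D.width * max (CNF.vars φ).card 1 := by ring

end TreeDecomposition

/-! ### One-sided treewidth is attained -/

/-- The rooted tree with one node. -/
def singletonTree : RootedTree.{0} :=
  letI : PredOrder Unit :=
    { pred := id
      pred_le := fun _ => le_rfl
      min_of_le_pred := fun _ => isMin_iff_eq_bot.2 rfl
      le_pred_of_lt := fun h => h.le }
  { α := Unit
    isPredArchimedean := ⟨fun _ => ⟨0, rfl⟩⟩ }

/-- The bag of the single node contains everything. -/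
lemma CNF.exists_isOneSided {α : Type u} [DecidableEq α] (φ : CNF α) :
    ∃ (T : RootedTree.{0}) (_ : Fintype T) (D : TreeDecomposition (CNF.incidenceGraph φ) T),
      D.IsOneSided := by
  classical
  have : Subsingleton singletonTree := inferInstanceAs (Subsingleton Unit)
  refine ⟨singletonTree, inferInstanceAs (Fintype Unit),
    { bag := fun _ => Finset.univ
      union := fun x => ⟨⊥, Finset.mem_univ x⟩
      containment := fun x y _ => ⟨⊥, Finset.mem_univ x, Finset.mem_univ y⟩
      connectivity := fun x => ?_ }, ?_⟩
  · have : Nonempty {t : singletonTree | x ∈ (Finset.univ : Finset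
      ({x : α // x ∈ CNF.vars φ} ⊕ {C : Clause α // C ∈ φ}))} := ⟨⊥, Finset.mem_univ x⟩
    exact ⟨SimpleGraph.Preconnected.of_subsingleton⟩
  · intro C
    refine ⟨[⊥], List.isChain_singleton _, fun t => ?_⟩
    simp [Subsingleton.elim t ⊥]

/-- An infimum in `ℕ` is attained only over a nonempty set; the one-node decomposition supplies an
element. -/
lemma CNF.exists_width_eq_oneSidedTreewidth {α : Type u} [DecidableEq α] (φ : CNF α) :
    ∃ (T : RootedTree.{0}) (_ : Fintype T) (D : TreeDecomposition (CNF.incidenceGraph φ) T),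
      D.IsOneSided ∧ D.width = φ.oneSidedTreewidth := by
  obtain ⟨T, hT, D, hD⟩ := φ.exists_isOneSided
  exact Nat.sInf_mem (s := {w : ℕ | ∃ (T : RootedTree.{0}) (_ : Fintype T)
    (D : TreeDecomposition (CNF.incidenceGraph φ) T), D.IsOneSided ∧ D.width = w})
    ⟨D.width, T, hT, D, hD, rfl⟩

end PropCNF

theorem mainTheorem2 :
    (∃ c : ℕ, ∀ (α : Type u) [DecidableEq α] (φ : PropCNF.CNF α),
      PropCNF.CNF.Unsatisfiable φ →
      ∀ (T : RootedTree.{v}) [Fintype T]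
        (D : PropCNF.TreeDecomposition (PropCNF.CNF.incidenceGraph φ) T) (k : ℕ),
        D.IsOneSided → D.width = k →
        ∃ H : PropCNF.BranchingProgram α, H.IsRegularResolution φ ∧
          H.size ≤ c * 4 ^ k * max (PropCNF.CNF.vars φ).card 1) ∧
    (∃ (f : ℕ → ℕ) (d : ℕ), ∀ (α : Type u) [DecidableEq α] (φ : PropCNF.CNF α) (k : ℕ),
      PropCNF.CNF.Unsatisfiable φ → PropCNF.CNF.oneSidedTreewidth φ ≤ k →
      ∃ H : PropCNF.BranchingProgram α, H.IsRegularResolution φ ∧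
        H.size ≤ f k * max (PropCNF.CNF.vars φ).card 1 ^ d) := by
  refine ⟨⟨3, ?_⟩, fun k => 3 * 4 ^ k, 1, ?_⟩
  · rintro α _ φ hφ T _ D k hD rfl
    exact hD.exists_isRegularResolution_of_width hφ
  · intro α _ φ k hφ hk
    obtain ⟨T, _, D, hD, hw⟩ := φ.exists_width_eq_oneSidedTreewidth
    obtain ⟨H, hH, hsize⟩ := hD.exists_isRegularResolution_of_width hφ
    refine ⟨H, hH, hsize.trans ?_⟩
    rw [hw, pow_one]
    exact Nat.mul_le_mul_right _ (Nat.mul_le_mul_left _ (Nat.pow_le_pow_right (by lia) hk))
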